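/- Write $B(x,r)$ for the closed ball with centre $x$ and radius $r$ in $\mathbb{R}^d$ (Euclidean norm), and, for a set $A$, let $N_r(A)$ be the least number of closed balls of radius $r$ with centres in $A$ that cover $A$. The lower dimension of a non-empty compact set $K\subset\mathbb{R}^d$ is $$\dim_{\mathrm L}K=\sup\Bigl\{\alpha>0:\ (\exists C>0)(\forall\,0<r\le R<1)(\forall x\in K)\quad N_r\bigl(B(x,R)\cap K\bigr)\ge C\Bigl(\frac Rr\Bigr)^{\alpha}\Bigr\},\qquad \sup\varnothing:=0.$$ A weak tangent of $K$ is a non-empty compact set $F$ which is the limit in the Hausdorff metric of a sequence of sets $\lambda_n(K-x_n)\cap B(0,1)$ with $x_n\in K$, $\lambda_n\ge 1$ and $\lambda_n\to\infty$. For $s\ge 0$ the $s$-dimensional packing pre-measure and packing measure of $A\subset\mathbb{R}^d$ are $$\mathcal P^s_0(A)=\lim_{\delta\to0}\ \sup\Bigl\{\sum_{i}(2r_i)^s:\ \{B(x_i,r_i)\}_i \text{ a finite or countable family of pairwise disjoint balls with } x_i\in A,\ 0<r_i\le\delta\Bigr\},$$ $$\mathcal P^s(A)=\inf\Bigl\{\sum_{i=1}^\infty\mathcal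 P^s_0(E_i):\ A\subset\bigcup_{i=1}^\infty E_i\Bigr\}.$$ **Theorem.** Let $K\subset\mathbb{R}^d$ be non-empty and compact, and let $\beta=\dim_{\mathrm L}K$. Then $\beta<\infty$, and there is a weak tangent $F$ of $K$ such that $$\mathcal P^\beta_0(F)\le 257^\beta .$$ In particular, $\mathcal P^\beta(F)<\infty$. -/

import Mathlib

open Set Filter Topology Metric
open scoped NNReal ENNReal

noncomputable section

namespace LowerTangent

/-- The exponent `α` is a lower exponent for `K`: there is `C > 0` such that for all
`0 < r ≤ R < 1` and all `x ∈ K`, at least `C (R / r) ^ α` closed balls of radius `r` centred in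
`B(x, R) ∩ K` are required to cover `B(x, R) ∩ K`. -/
def IsLowerExponent {X : Type*} [PseudoMetricSpace X] (K : Set X) (α : ℝ≥0) : Prop :=
  ∃ C : ℝ≥0, 0 < C ∧ ∀ r R : ℝ≥0, 0 < r → r ≤ R → R < 1 → ∀ x ∈ K,
    ((C * (R / r) ^ (α : ℝ) : ℝ≥0) : ℝ≥0∞)
      ≤ ((coveringNumber r (closedBall x (R : ℝ) ∩ K) : ℕ∞) : ℝ≥0∞)

/-- The lower dimension of `K`, the supremum of its positive lower exponents
(and `0` if there are none). -/
def lowerDim {X : Type*} [PseudoMetricSpace X] (K : Set X) : ℝ≥0∞ :=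
  ⨆ (α : ℝ≥0) (_ : 0 < α ∧ IsLowerExponent K α), (α : ℝ≥0∞)

/-- The miniset `c (K - x) ∩ B(0, 1)`. -/
def miniset {E : Type*} [NormedAddCommGroup E] [NormedSpace ℝ E] (K : Set E) (x : E) (c : ℝ) :
    Set E :=
  (fun y => c • (y - x)) '' K ∩ closedBall 0 1

/-- `F` is a weak tangent of `K`: a non-empty compact set which is the limit, in the Hausdorff
metric, of minisets `c n (K - x n) ∩ B(0, 1)` with `x n ∈ K`, `c n ≥ 1` and `c n → ∞`. -/
def IsWeakTangent {E : Type*} [NormedAddCommGroup E] [NormedSpace ℝ E] (K F : Set E) : Prop :=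
  F.Nonempty ∧ IsCompact F ∧
    ∃ (x : ℕ → E) (c : ℕ → ℝ), (∀ n, x n ∈ K) ∧ (∀ n, 1 ≤ c n) ∧ Tendsto c atTop atTop ∧
      Tendsto (fun n => hausdorffEDist (miniset K (x n) (c n)) F) atTop (𝓝 0)

/-- The balls `B(x i, r i)`, `i ∈ I`, form a `δ`-packing of `A`: they are pairwise disjoint closed
balls centred in `A`, with radii in `(0, δ]`. The index set `I` is finite or countably infinite. -/
def IsPacking {X : Type*} [PseudoMetricSpace X] (A : Set X) (δ : ℝ) (I : Set ℕ) (x : ℕ → X)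
    (r : ℕ → ℝ) : Prop :=
  (∀ i ∈ I, x i ∈ A ∧ 0 < r i ∧ r i ≤ δ) ∧
    I.PairwiseDisjoint (fun i => closedBall (x i) (r i))

/-- The supremum of `∑ (2 r i) ^ s` over all `δ`-packings of `A`. -/
def packingSup {X : Type*} [PseudoMetricSpace X] (s : ℝ) (A : Set X) (δ : ℝ) : ℝ≥0∞ :=
  ⨆ (I : Set ℕ) (x : ℕ → X) (r : ℕ → ℝ) (_ : IsPacking A δ I x r),
    ∑' i : I, ENNReal.ofReal ((2 * r i) ^ s)

/-- The `s`-dimensional packing pre-measure, the decreasing limit of `packingSup s A δ`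
as `δ → 0`. -/
def packingPreMeasure {X : Type*} [PseudoMetricSpace X] (s : ℝ) (A : Set X) : ℝ≥0∞ :=
  ⨅ (δ : ℝ) (_ : 0 < δ), packingSup s A δ

/-- The `s`-dimensional packing measure. -/
def packingMeasure {X : Type*} [PseudoMetricSpace X] (s : ℝ) (A : Set X) : ℝ≥0∞ :=
  ⨅ (E : ℕ → Set X) (_ : A ⊆ ⋃ i, E i), ∑' i, packingPreMeasure s (E i)

theorem packingSup_mono {X : Type*} [PseudoMetricSpace X] (s : ℝ) (A : Set X) :
    Monotone (packingSup s A) := by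
  intro δ δ' h
  refine iSup_mono fun I => iSup_mono fun x => iSup_mono fun r => iSup_mono' fun hp => ?_
  exact ⟨⟨fun i hi => ⟨(hp.1 i hi).1, (hp.1 i hi).2.1, (hp.1 i hi).2.2.trans h⟩, hp.2⟩, le_rfl⟩

/-- The infimum defining the packing pre-measure is the limit as `δ → 0` from above. -/
theorem tendsto_packingSup {X : Type*} [PseudoMetricSpace X] (s : ℝ) (A : Set X) :
    Tendsto (packingSup s A) (𝓝[>] 0) (𝓝 (packingPreMeasure s A)) := by
  have h := (packingSup_mono s A).tendsto_nhdsGT 0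
  rwa [sInf_image] at h

end LowerTangent

end

/-! Call a ball `B(x, ρ)` rich for an exponent `s` when it holds a separated family as in `IsRich`.
If all small balls centred in `K` are rich with one `η`, nesting the families gives a tree of balls
that conserves the sum of `s`-th powers of radii; stopping it at a fixed scale makes `s` a lower
exponent (`isLowerExponent_of_isRich`). Hence for exponents just above `β`, and with `η → 0`, there
are non-rich balls of radius tending to `0`.

Blow these balls up to unit size and let `F` be a limit of the blow-ups. A too large packing
pre-measure of `F` would be witnessed by a finite packing; finitely many strict inequalities survive
in nearby minisets (`eventually_isRich`), making some of the non-rich balls rich. -/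

namespace LowerTangent

/-! ### Trees of separated balls and lower exponents -/

section Tree

variable {X : Type*} [PseudoMetricSpace X]

/-- Pairs `(y, r)`, standing for the balls `B(y, r)`, are separated if the distance between any two
of the centres exceeds the sum of the radii. -/
def SeparatedBalls (T : Finset (X × ℝ)) : Prop :=
  (T : Set (X × ℝ)).Pairwise fun p q => p.2 + q.2 < dist p.1 q.1

/-- `K` is rich in `B(x, ρ)`: there are separated balls centred in `K ∩ B(x, ρ)`, with radii
in `[η ρ, ρ]`, for which the sum of the `s`-th powers of the radii is at least `(2 ρ) ^ s`. -/
def IsRich (K : Set X) (s η : ℝ) (x : X) (ρ : ℝ) : Prop :=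
  ∃ T : Finset (X × ℝ), (∀ p ∈ T, p.1 ∈ K ∧ dist p.1 x ≤ ρ ∧ η * ρ ≤ p.2 ∧ p.2 ≤ ρ) ∧
    SeparatedBalls T ∧ (2 * ρ) ^ s ≤ ∑ p ∈ T, p.2 ^ s

/-- A stopping-time construction: a ball is kept once its radius is at most `r`, and otherwise
replaced by the family from richness. Each replacement at least halves the radius, so `n` rounds
suffice. -/
theorem exists_separatedBalls_of_isRich {K : Set X} {s η R₀ r : ℝ} (hη : 0 < η) (hr : 0 < r)
    (h : ∀ x ∈ K, ∀ ρ, 0 < ρ → ρ ≤ R₀ → IsRich K s η x ρ) (n : ℕ) :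
    ∀ x ∈ K, ∀ R, R ≤ R₀ → η / 2 * r ≤ R → R ≤ 2 ^ n * r →
      ∃ T : Finset (X × ℝ),
        (∀ p ∈ T, p.1 ∈ K ∧ dist p.1 x + p.2 ≤ R ∧ η / 2 * r ≤ p.2 ∧ p.2 ≤ r) ∧
        SeparatedBalls T ∧ R ^ s ≤ ∑ p ∈ T, p.2 ^ s := by
  classical
  have base : ∀ x ∈ K, ∀ R, η / 2 * r ≤ R → R ≤ r →
      ∃ T : Finset (X × ℝ),
        (∀ p ∈ T, p.1 ∈ K ∧ dist p.1 x + p.2 ≤ R ∧ η / 2 * r ≤ p.2 ∧ p.2 ≤ r) ∧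
        SeparatedBalls T ∧ R ^ s ≤ ∑ p ∈ T, p.2 ^ s := by
    intro x hx R h1 h2
    refine ⟨{(x, R)}, ?_, ?_, ?_⟩
    · simp [hx, h1, h2]
    · simp [SeparatedBalls]
    · simp
  induction n with
  | zero =>
    intro x hx R _ h1 h2
    exact base x hx R h1 (by simpa using h2)
  | succ n ih =>
    intro x hx R hR h1 h2
    rcases le_total R r with hRr | hRr
    · exact base x hx R h1 hRr
    have hRpos : 0 < R := hr.trans_le hRr
    -- At radius `R / 2` the new balls stay inside `B(x, R)`, and the factor `2` in `IsRich`
    -- restores `R ^ s`. Since `R ≥ r`, the new radii are at least `η / 2 * r`.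
    obtain ⟨T, hT, hTs, hTsum⟩ := h x hx (R / 2) (by positivity) (by linarith)
    have key : ∀ p ∈ T, ∃ S : Finset (X × ℝ),
        (∀ q ∈ S, q.1 ∈ K ∧ dist q.1 p.1 + q.2 ≤ p.2 ∧ η / 2 * r ≤ q.2 ∧ q.2 ≤ r) ∧
        SeparatedBalls S ∧ p.2 ^ s ≤ ∑ q ∈ S, q.2 ^ s := by
      intro p hp
      obtain ⟨hpK, -, hp1, hp2⟩ := hT p hp
      refine ih p.1 hpK p.2 (by linarith) ?_ ?_
      · nlinarith
      · rw [pow_succ] at h2; linarith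
    choose! S hS hSs hSsum using key
    have hpos : 0 < η / 2 * r := by positivity
    have cross : ∀ p ∈ T, ∀ p' ∈ T, p ≠ p' → ∀ q ∈ S p, ∀ q' ∈ S p',
        q.2 + q'.2 < dist q.1 q'.1 := by
      intro p hp p' hp' hne q hq q' hq'
      have h3 := hTs hp hp' hne
      have h4 := (hS p hp q hq).2.1
      have h5 := (hS p' hp' q' hq').2.1
      have h6 := dist_triangle4 p.1 q.1 q'.1 p'.1
      rw [dist_comm p.1 q.1] at h6
      linarith
    refine ⟨T.biUnion S, ?_, ?_, ?_⟩
    · intro q hq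
      obtain ⟨p, hp, hqp⟩ := Finset.mem_biUnion.1 hq
      obtain ⟨h3, h4, h5, h6⟩ := hS p hp q hqp
      obtain ⟨-, h7, -, h8⟩ := hT p hp
      refine ⟨h3, ?_, h5, h6⟩
      have := dist_triangle q.1 p.1 x
      linarith
    · intro q hq q' hq' hne
      obtain ⟨p, hp, hqp⟩ := Finset.mem_biUnion.1 (Finset.mem_coe.1 hq)
      obtain ⟨p', hp', hqp'⟩ := Finset.mem_biUnion.1 (Finset.mem_coe.1 hq')
      by_cases hpp : p = p'
      · subst hpp
        exact hSs p hp hqp hqp' hne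
      · exact cross p hp p' hp' hpp q hqp q' hqp'
    · rw [Finset.sum_biUnion]
      · calc R ^ s = (2 * (R / 2)) ^ s := by congr 1; ring
          _ ≤ ∑ p ∈ T, p.2 ^ s := hTsum
          _ ≤ _ := Finset.sum_le_sum hSsum
      · intro p hp p' hp' hne
        refine Finset.disjoint_left.2 fun q hq hq' => ?_
        have h3 := cross p hp p' hp' hne q hq q hq'
        have h4 := (hS p hp q hq).2.2.1
        rw [dist_self] at h3
        linarith

theorem card_le_coveringNumber_of_separatedBalls {A : Set X} {T : Finset (X × ℝ)} {r : ℝ≥0}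
    (hT : SeparatedBalls T) (hA : ∀ p ∈ T, p.1 ∈ A) (hr : ∀ p ∈ T, (r : ℝ) ≤ p.2) :
    (T.card : ℕ∞) ≤ coveringNumber r A := by
  have hinj : Set.InjOn Prod.fst (T : Set (X × ℝ)) := by
    intro p hp q hq hpq
    by_contra hne
    have h1 : p.2 + q.2 < dist p.1 q.1 := hT hp hq hne
    rw [hpq, dist_self] at h1
    have h2 := hr p hp
    have h3 := hr q hq
    have := r.coe_nonneg
    linarith
  have hsep : IsSeparated ((2 * r : ℝ≥0) : ℝ≥0∞) (Prod.fst '' (T : Set (X × ℝ))) := by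
    rintro _ ⟨p, hp, rfl⟩ _ ⟨q, hq, rfl⟩ hne
    have h1 := hT hp hq (fun h => hne (by rw [h]))
    have h2 := hr p hp
    have h3 := hr q hq
    rw [edist_nndist, ENNReal.coe_lt_coe, ← NNReal.coe_lt_coe, coe_nndist]
    push_cast
    linarith
  calc (T.card : ℕ∞) = (Prod.fst '' (T : Set (X × ℝ))).encard := by
        rw [hinj.encard_image, Set.encard_coe_eq_coe_finsetCard]
    _ ≤ packingNumber (2 * r) A :=
        hsep.encard_le_packingNumber (by rintro _ ⟨p, hp, rfl⟩; exact hA p hp)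
    _ ≤ externalCoveringNumber r A := packingNumber_two_mul_le_externalCoveringNumber r A
    _ ≤ coveringNumber r A := externalCoveringNumber_le_coveringNumber r A

theorem isLowerExponent_of_isRich {K : Set X} {s : ℝ≥0} {η R₀ : ℝ} (hη : 0 < η) (hη1 : η ≤ 1)
    (hR₀ : 0 < R₀) (hR₀1 : R₀ ≤ 1) (h : ∀ x ∈ K, ∀ ρ, 0 < ρ → ρ ≤ R₀ → IsRich K s η x ρ) :
    IsLowerExponent K s := by
  lift η to ℝ≥0 using hη.le
  lift R₀ to ℝ≥0 using hR₀.le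
  norm_cast at hη hη1 hR₀ hR₀1
  refine ⟨(R₀ * (η / 2)) ^ (s : ℝ), NNReal.rpow_pos (by positivity), ?_⟩
  intro r' R hr' hrR hR1 x hx
  -- Stopping scale for which the smallest radius in the tree, `η / 2 * r`, is the covering radius
  -- `r'`.
  set r : ℝ≥0 := 2 * r' / η with hrdef
  have hr : 0 < r := by positivity
  have hr'r : r' = η / 2 * r := by rw [hrdef]; field_simp
  rw [← NNReal.mul_rpow]
  have hbase : R₀ * (η / 2) * (R / r') = R₀ * R / r := by
    rw [hr'r]; field_simp
  rw [hbase]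
  rcases le_total (R₀ * R) r with hle | hle
  · have h1 : (R₀ * R / r) ^ (s : ℝ) ≤ 1 :=
      NNReal.rpow_le_one (div_le_one_of_le₀ hle zero_le) s.2
    have h2 : (1 : ℕ∞) ≤ coveringNumber r' (closedBall x (R : ℝ) ∩ K) := by
      rw [Order.one_le_iff_pos, coveringNumber_pos_iff]
      exact ⟨x, mem_closedBall_self R.2, hx⟩
    calc (((R₀ * R / r) ^ (s : ℝ) : ℝ≥0) : ℝ≥0∞) ≤ ((1 : ℝ≥0) : ℝ≥0∞) := ENNReal.coe_le_coe.2 h1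
      _ = ((1 : ℕ∞) : ℝ≥0∞) := by simp
      _ ≤ _ := ENat.toENNReal_le.2 h2
  · obtain ⟨n, hn⟩ := pow_unbounded_of_one_lt ((R₀ * R : ℝ≥0) / r : ℝ) one_lt_two
    have hr'le : η / 2 * r ≤ R₀ * R :=
      (mul_le_of_le_one_left' ((half_le_self zero_le).trans hη1)).trans hle
    obtain ⟨T, hT, hTs, hTsum⟩ := exists_separatedBalls_of_isRich (r := r) (NNReal.coe_pos.2 hη)
      (NNReal.coe_pos.2 hr) h n x hx (R₀ * R : ℝ≥0)
      (NNReal.coe_le_coe.2 (mul_le_of_le_one_right' hR1.le))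
      (by exact_mod_cast hr'le)
      (by rw [div_lt_iff₀ (NNReal.coe_pos.2 hr)] at hn; exact hn.le)
    have hcard := card_le_coveringNumber_of_separatedBalls (A := closedBall x (R : ℝ) ∩ K)
      (r := r') hTs ?_ ?_
    · have h1 : (R₀ * R / r) ^ (s : ℝ) ≤ (T.card : ℝ≥0) := by
        rw [← NNReal.coe_le_coe]
        push_cast
        rw [Real.div_rpow (by positivity) r.coe_nonneg, div_le_iff₀ (Real.rpow_pos_of_pos (NNReal.coe_pos.2 hr) _)]
        calc ((R₀ : ℝ) * R) ^ (s : ℝ) ≤ ∑ p ∈ T, p.2 ^ (s : ℝ) := by simpa using hTsum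
          _ ≤ ∑ p ∈ T, (r : ℝ) ^ (s : ℝ) := by
              refine Finset.sum_le_sum fun p hp => ?_
              obtain ⟨-, -, h3, h4⟩ := hT p hp
              exact Real.rpow_le_rpow (le_trans (by positivity) h3) h4 s.2
          _ = _ := by simp
      calc (((R₀ * R / r) ^ (s : ℝ) : ℝ≥0) : ℝ≥0∞) ≤ ((T.card : ℝ≥0) : ℝ≥0∞) :=
            ENNReal.coe_le_coe.2 h1
        _ = ((T.card : ℕ∞) : ℝ≥0∞) := by simp
        _ ≤ _ := ENat.toENNReal_le.2 hcard
    · intro p hp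
      obtain ⟨h1, h2, h3, -⟩ := hT p hp
      refine ⟨?_, h1⟩
      rw [mem_closedBall]
      have h4 : (0 : ℝ) < η / 2 * r := by positivity
      have h5 : ((R₀ * R : ℝ≥0) : ℝ) ≤ R := NNReal.coe_le_coe.2 (mul_le_of_le_one_left' hR₀1)
      linarith
    · intro p hp
      rw [hr'r]
      exact_mod_cast (hT p hp).2.2.1

end Tree

/-! ### Finiteness of the lower dimension by volume comparison -/

section Upper

open MeasureTheory Module

variable {E : Type*} [NormedAddCommGroup E] [NormedSpace ℝ E] [FiniteDimensional ℝ E]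

theorem card_le_of_isSeparated_closedBall {x : E} {R r : ℝ≥0} {t : Finset E} (hr : 0 < r)
    (ht : ∀ y ∈ t, y ∈ closedBall x (R : ℝ)) (hs : IsSeparated (r : ℝ≥0∞) (t : Set E)) :
    (t.card : ℝ) ≤ ((2 * R + r) / r : ℝ) ^ finrank ℝ E := by
  borelize E
  let μ : Measure E := Measure.addHaar
  have hr' : (0 : ℝ) < r := hr
  have hR := R.coe_nonneg
  have hdisj : (t : Set E).PairwiseDisjoint fun y => closedBall y (r / 2 : ℝ) := by
    intro y hy z hz hne
    apply closedBall_disjoint_closedBall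
    have h1 : (r : ℝ≥0∞) < edist y z := hs hy hz hne
    rw [edist_nndist, ENNReal.coe_lt_coe, ← NNReal.coe_lt_coe, coe_nndist] at h1
    linarith
  have hle : ∑ y ∈ t, μ.real (closedBall y (r / 2 : ℝ)) ≤ μ.real (closedBall x (R + r / 2 : ℝ)) := by
    rw [← measureReal_biUnion_finset hdisj (fun _ _ => measurableSet_closedBall)
      (fun _ _ => measure_closedBall_lt_top.ne)]
    refine measureReal_mono (Set.iUnion₂_subset fun y hy => closedBall_subset_closedBall' ?_)
      measure_closedBall_lt_top.ne
    have := mem_closedBall.1 (ht y hy)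
    linarith
  have h1 : 0 < μ.real (ball (0 : E) 1) :=
    ENNReal.toReal_pos (measure_ball_pos μ _ one_pos).ne' measure_ball_lt_top.ne
  simp only [Measure.addHaar_real_closedBall μ _ (show (0 : ℝ) ≤ r / 2 by positivity),
    Measure.addHaar_real_closedBall μ _ (show (0 : ℝ) ≤ R + r / 2 by positivity),
    Finset.sum_const, nsmul_eq_mul] at hle
  rw [← mul_assoc] at hle
  have h2 := le_of_mul_le_mul_right hle h1
  rw [← le_div_iff₀ (by positivity), ← div_pow] at h2
  convert! h2 using 2
  field_simp

theorem coveringNumber_closedBall_inter_le (K : Set E) (x : E) {R r : ℝ≥0} (hr : 0 < r) :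
    ((coveringNumber r (closedBall x (R : ℝ) ∩ K) : ℕ∞) : ℝ≥0∞) ≤
      (((2 * R + r) / r) ^ finrank ℝ E : ℝ≥0) := by
  have key : packingNumber r (closedBall x (R : ℝ) ∩ K) ≤
      (⌊((2 * R + r) / r) ^ finrank ℝ E⌋₊ : ℕ∞) := by
    refine iSup₂_le fun C hC => iSup_le fun hsep => ?_
    by_contra! hlt
    -- Passing to a subset of exactly floor plus one points also covers infinite `C`.
    have hlt' := Order.add_one_le_of_lt hlt
    obtain ⟨t, htC, ht⟩ := Set.exists_subset_encard_eq hlt'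
    have hfin : t.Finite := Set.finite_of_encard_eq_coe (k := _ + 1) (by exact_mod_cast ht)
    lift t to Finset E using hfin
    have h1 := card_le_of_isSeparated_closedBall (R := R) (x := x) hr
      (fun y hy => (hC (htC hy)).1) (hsep.subset htC)
    rw [Set.encard_coe_eq_coe_finsetCard] at ht
    norm_cast at ht
    have h2 : (t.card : ℝ≥0) ≤ ((2 * R + r) / r) ^ finrank ℝ E := by exact_mod_cast h1
    have h3 := Nat.le_floor h2
    omega
  calc ((coveringNumber r (closedBall x (R : ℝ) ∩ K) : ℕ∞) : ℝ≥0∞)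
      ≤ ((⌊((2 * R + r) / r) ^ finrank ℝ E⌋₊ : ℕ∞) : ℝ≥0∞) :=
        ENat.toENNReal_le.2 ((coveringNumber_le_packingNumber _ _).trans key)
    _ = ((⌊((2 * R + r) / r) ^ finrank ℝ E⌋₊ : ℝ≥0) : ℝ≥0∞) := by simp
    _ ≤ _ := ENNReal.coe_le_coe.2 (Nat.floor_le zero_le)

theorem IsLowerExponent.le_finrank {K : Set E} (hne : K.Nonempty) {α : ℝ≥0}
    (h : IsLowerExponent K α) : α ≤ finrank ℝ E := by
  obtain ⟨x, hx⟩ := hne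
  obtain ⟨C, hC, h⟩ := h
  by_contra! hlt
  have hlt' : (0 : ℝ) < α - finrank ℝ E := by
    rw [sub_pos]; exact_mod_cast hlt
  -- Compare both bounds at radii `1 / 2` and `1 / (2 t)`; letting `t → ∞` contradicts `α > finrank
  -- ℝ E`.
  have key : ∀ t : ℝ, 1 ≤ t → C * t ^ ((α : ℝ) - finrank ℝ E) ≤ 3 ^ finrank ℝ E := by
    intro t ht
    have htpos : 0 < t := by linarith
    lift t to ℝ≥0 using htpos.le
    norm_cast at ht
    have htpos' : 0 < t := by exact_mod_cast htpos
    have h1 := (h (1 / 2 / t) (1 / 2) (by positivity) (div_le_self zero_le ht)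
      (by exact half_lt_self one_pos) x hx).trans
      (coveringNumber_closedBall_inter_le K x (by positivity))
    rw [ENNReal.coe_le_coe] at h1
    have e1 : (1 / 2 : ℝ≥0) / (1 / 2 / t) = t := by field_simp
    have e2 : (2 * (1 / 2) + 1 / 2 / t : ℝ≥0) / (1 / 2 / t) ≤ 3 * t := by
      rw [div_le_iff₀ (by positivity)]
      have : 3 * t * (1 / 2 / t) = (3 / 2 : ℝ≥0) := by field_simp
      rw [this]
      have h2 : 1 / 2 / t ≤ (1 / 2 : ℝ≥0) := div_le_self zero_le ht
      rw [← NNReal.coe_le_coe] at h2 ⊢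
      push_cast at h2 ⊢
      linarith
    rw [e1] at h1
    have h3 : C * t ^ (α : ℝ) ≤ (3 * t) ^ finrank ℝ E := h1.trans (pow_le_pow_left' e2 _)
    have h4 : (C : ℝ) * (t : ℝ) ^ (α : ℝ) ≤ (3 * t : ℝ) ^ finrank ℝ E := by exact_mod_cast h3
    rw [Real.rpow_sub htpos, Real.rpow_natCast, ← mul_div_assoc,
      div_le_iff₀ (by positivity), ← mul_pow]
    exact h4
  have hlim := (tendsto_rpow_atTop hlt').const_mul_atTop (NNReal.coe_pos.2 hC)
  obtain ⟨t, ht1, ht2⟩ := ((hlim.eventually_gt_atTop (3 ^ finrank ℝ E)).and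
    (eventually_ge_atTop 1)).exists
  exact absurd (key t ht2) (not_le.2 ht1)

theorem lowerDim_le_finrank {K : Set E} (hne : K.Nonempty) :
    lowerDim K ≤ finrank ℝ E :=
  iSup₂_le fun _ hα => by exact_mod_cast hα.2.le_finrank hne

end Upper

/-! ### Packings of limits of minisets, and the weak tangent -/

section Packing

theorem packingPreMeasure_empty {X : Type*} [PseudoMetricSpace X] (s : ℝ) :
    packingPreMeasure s (∅ : Set X) = 0 := by
  refine le_antisymm (iInf₂_le_of_le 1 one_pos ?_) zero_le
  refine iSup_le fun I => iSup_le fun x => iSup_le fun r => iSup_le fun h => ?_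
  have : IsEmpty I := ⟨fun i => (h.1 i i.2).1⟩
  simp

theorem packingMeasure_le_packingPreMeasure {X : Type*} [PseudoMetricSpace X] (s : ℝ) (A : Set X) :
    packingMeasure s A ≤ packingPreMeasure s A := by
  refine iInf₂_le_of_le (fun n => if n = 0 then A else ∅)
    (fun y hy => mem_iUnion.2 ⟨0, by simpa using hy⟩) ?_
  rw [tsum_eq_single 0]
  · simp
  · intro n hn
    simp [hn, packingPreMeasure_empty]

variable {E : Type*} [NormedAddCommGroup E] [NormedSpace ℝ E]

/-- A finite partial sum already exceeds `M`. In a normed space, disjoint closed balls have centres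
further apart than the sum of the radii. -/
theorem exists_separatedBalls_of_lt_packingPreMeasure {s : ℝ} {A : Set E} {M : ℝ≥0∞}
    (h : M < packingPreMeasure s A) {δ : ℝ} (hδ : 0 < δ) :
    ∃ T : Finset (E × ℝ), (∀ p ∈ T, p.1 ∈ A ∧ 0 < p.2 ∧ p.2 ≤ δ) ∧ SeparatedBalls T ∧
      M < ENNReal.ofReal (∑ p ∈ T, (2 * p.2) ^ s) := by
  classical
  have h1 : M < packingSup s A δ := h.trans_le (iInf₂_le δ hδ)
  simp only [packingSup, lt_iSup_iff] at h1
  obtain ⟨I, x, r, hp, hM⟩ := h1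
  rw [ENNReal.tsum_eq_iSup_sum, lt_iSup_iff] at hM
  obtain ⟨J, hJ⟩ := hM
  have hsep : ∀ i j : I, i ≠ j → r i + r j < dist (x i) (x j) := fun i j hij =>
    (disjoint_closedBall_closedBall_iff (hp.1 i i.2).2.1.le (hp.1 j j.2).2.1.le).1
      (hp.2 i.2 j.2 fun h => hij (Subtype.ext h))
  have hinj : Function.Injective fun i : I => (x i, r i) := by
    intro i j hij
    by_contra hne
    have h2 := hsep i j hne
    rw [(Prod.mk.inj hij).1, dist_self] at h2
    linarith [(hp.1 i i.2).2.1, (hp.1 j j.2).2.1]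
  refine ⟨J.image fun i : I => (x i, r i), ?_, ?_, ?_⟩
  · intro p hpJ
    obtain ⟨i, -, rfl⟩ := Finset.mem_image.1 hpJ
    exact hp.1 i i.2
  · intro p hpJ q hqJ hne
    obtain ⟨i, -, rfl⟩ := Finset.mem_image.1 (Finset.mem_coe.1 hpJ)
    obtain ⟨j, -, rfl⟩ := Finset.mem_image.1 (Finset.mem_coe.1 hqJ)
    exact hsep i j fun h => hne (by rw [h])
  · rw [Finset.sum_image hinj.injOn, ENNReal.ofReal_sum_of_nonneg]
    · exact hJ
    · intro i _
      have := (hp.1 i i.2).2.1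
      positivity

/-- Separation and the sum condition are strict and `T` is finite, so both persist when the centres
move slightly into the miniset and the exponent varies; scaling by `(c n)⁻¹` then returns to `K`. -/
theorem eventually_isRich {K F : Set E} {x : ℕ → E} {c t η : ℕ → ℝ} {s : ℝ}
    (hc : ∀ n, 0 < c n)
    (hF : Tendsto (fun n => hausdorffEDist (miniset K (x n) (c n)) F) atTop (𝓝 0))
    (ht : Tendsto t atTop (𝓝 s)) (hη : Tendsto η atTop (𝓝 0)) {T : Finset (E × ℝ)}
    (hT : ∀ p ∈ T, p.1 ∈ F ∧ 0 < p.2 ∧ p.2 ≤ 1) (hTs : SeparatedBalls T)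
    (hsum : 2 ^ s < ∑ p ∈ T, p.2 ^ s) :
    ∀ᶠ n in atTop, IsRich K (t n) (η n) (x n) (c n)⁻¹ := by
  classical
  -- The slack `2 * ε` pays for moving both centres by less than `ε`.
  obtain ⟨ε, hε, hεpos⟩ : ∃ ε : ℝ, (∀ p ∈ T, ∀ q ∈ T, p ≠ q → p.2 + q.2 + 2 * ε < dist p.1 q.1) ∧
      0 < ε := by
    have : ∀ᶠ ε in 𝓝[>] (0 : ℝ), ∀ p ∈ T, ∀ q ∈ T, p ≠ q → p.2 + q.2 + 2 * ε < dist p.1 q.1 := by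
      refine (Filter.eventually_all_finset T).2 fun p hp =>
        (Filter.eventually_all_finset T).2 fun q hq => ?_
      by_cases hpq : p = q
      · simp [hpq]
      have h1 : Tendsto (fun ε : ℝ => p.2 + q.2 + 2 * ε) (𝓝[>] 0) (𝓝 (p.2 + q.2 + 2 * 0)) :=
        ((continuous_const.add (continuous_const.mul continuous_id)).tendsto _).mono_left
          nhdsWithin_le_nhds
      have h2 : p.2 + q.2 + 2 * 0 < dist p.1 q.1 := by simpa using hTs hp hq hpq
      exact (h1.eventually_lt_const h2).mono fun _ h _ => h
    exact (this.and self_mem_nhdsWithin).exists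
  have e1 := hF.eventually_lt_const (ENNReal.ofReal_pos.2 hεpos)
  have e2 : ∀ᶠ n in atTop, ∀ p ∈ T, η n ≤ p.2 :=
    (Filter.eventually_all_finset T).2 fun p hp => hη.eventually_le_const (hT p hp).2.1
  have e3 : ∀ᶠ n in atTop, 2 ^ t n < ∑ p ∈ T, p.2 ^ t n := by
    refine Tendsto.eventually_lt (tendsto_const_nhds.rpow ht (Or.inl two_ne_zero))
      (tendsto_finsetSum _ fun p hp => ?_) hsum
    exact tendsto_const_nhds.rpow ht (Or.inl (hT p hp).2.1.ne')
  filter_upwards [e1, e2, e3] with n h1 h2 h3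
  have hcn := hc n
  have key : ∀ p ∈ T, ∃ z ∈ K, ‖c n • (z - x n)‖ ≤ 1 ∧ dist p.1 (c n • (z - x n)) < ε := by
    intro p hp
    rw [hausdorffEDist_comm] at h1
    obtain ⟨w, ⟨⟨z, hz, rfl⟩, hw⟩, hd⟩ := exists_edist_lt_of_hausdorffEDist_lt (hT p hp).1 h1
    refine ⟨z, hz, by simpa using hw, ?_⟩
    rwa [edist_dist, ENNReal.ofReal_lt_ofReal_iff hεpos] at hd
  choose! z hzK hz1 hzd using key
  have hsep : ∀ p ∈ T, ∀ q ∈ T, p ≠ q → p.2 / c n + q.2 / c n < dist (z p) (z q) := by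
    intro p hp q hq hpq
    have h4 := hε p hp q hq hpq
    have h5 := hzd p hp
    have h6 := hzd q hq
    have h8 : dist (c n • (z p - x n)) (c n • (z q - x n)) = c n * dist (z p) (z q) := by
      rw [dist_smul₀, dist_sub_right, Real.norm_of_nonneg hcn.le]
    have h9 := dist_triangle4 p.1 (c n • (z p - x n)) (c n • (z q - x n)) q.1
    rw [h8, dist_comm (c n • (z q - x n)) q.1] at h9
    rw [← add_div, div_lt_iff₀ hcn]
    linarith
  have hinj : Set.InjOn (fun p => (z p, p.2 / c n)) (T : Set (E × ℝ)) := by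
    intro p hp q hq hpq
    by_contra hne
    have h4 := hsep p hp q hq hne
    rw [(Prod.mk.inj hpq).1, dist_self, ← add_div, div_lt_iff₀ hcn] at h4
    linarith [(hT p hp).2.1, (hT q hq).2.1]
  refine ⟨T.image fun p => (z p, p.2 / c n), ?_, ?_, ?_⟩
  · intro p' hp'
    obtain ⟨p, hp, rfl⟩ := Finset.mem_image.1 hp'
    refine ⟨hzK p hp, ?_, ?_, ?_⟩
    · have h4 := hz1 p hp
      rw [norm_smul, Real.norm_of_nonneg hcn.le] at h4
      rw [dist_eq_norm, ← one_div, le_div_iff₀ hcn, mul_comm]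
      exact h4
    · rw [← div_eq_mul_inv]
      exact div_le_div_of_nonneg_right (h2 p hp) hcn.le
    · rw [← one_div]
      exact div_le_div_of_nonneg_right (hT p hp).2.2 hcn.le
  · intro p' hp' q' hq' hne
    obtain ⟨p, hp, rfl⟩ := Finset.mem_image.1 (Finset.mem_coe.1 hp')
    obtain ⟨q, hq, rfl⟩ := Finset.mem_image.1 (Finset.mem_coe.1 hq')
    exact hsep p hp q hq fun h => hne (by rw [h])
  · rw [Finset.sum_image hinj, ← div_eq_mul_inv, Real.div_rpow zero_le_two hcn.le]
    calc 2 ^ t n / c n ^ t n ≤ (∑ p ∈ T, p.2 ^ t n) / c n ^ t n := by gcongr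
      _ = ∑ p ∈ T, (p.2 / c n) ^ t n := by
        rw [Finset.sum_div]
        exact Finset.sum_congr rfl fun p hp => (Real.div_rpow (hT p hp).2.1.le hcn.le _).symm

/-- Blaschke selection: all minisets lie in the compact unit ball, and each contains `0`. -/
theorem exists_subseq_tendsto_miniset [FiniteDimensional ℝ E] {K : Set E} (hK : IsCompact K)
    {x : ℕ → E} (hx : ∀ n, x n ∈ K) (c : ℕ → ℝ) :
    ∃ (F : Set E) (φ : ℕ → ℕ), F.Nonempty ∧ IsCompact F ∧ StrictMono φ ∧
      Tendsto (fun n => hausdorffEDist (miniset K (x (φ n)) (c (φ n))) F) atTop (𝓝 0) := by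
  have : ProperSpace E := FiniteDimensional.proper ℝ E
  let M : ℕ → TopologicalSpace.NonemptyCompacts E := fun n =>
    { carrier := miniset K (x n) (c n)
      isCompact' := (hK.image (by fun_prop)).inter_right isClosed_closedBall
      nonempty' := ⟨0, ⟨x n, hx n, by simp⟩, by simp⟩ }
  obtain ⟨F, -, φ, hφ, hF⟩ :=
    (TopologicalSpace.NonemptyCompacts.isCompact_subsets_of_isCompact
      (isCompact_closedBall (0 : E) 1)).tendsto_subseq (x := M) fun n => inter_subset_right
  refine ⟨F, φ, F.nonempty, F.isCompact, hφ, ?_⟩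
  exact tendsto_iff_edist_tendsto_0.1 hF

theorem exists_isWeakTangent_packingPreMeasure_le [FiniteDimensional ℝ E] {K : Set E}
    (hne : K.Nonempty) (hK : IsCompact K) :
    ∃ F : Set E, IsWeakTangent K F ∧ packingPreMeasure (lowerDim K).toReal F
      ≤ (257 : ℝ≥0∞) ^ (lowerDim K).toReal := by
  have htop : lowerDim K ≠ ⊤ :=
    ((lowerDim_le_finrank hne).trans_lt (ENNReal.natCast_lt_top _)).ne
  set β : ℝ≥0 := (lowerDim K).toNNReal with hβ
  have hβ' : (lowerDim K).toReal = β := rfl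
  -- The single parameter `1 / (n + 1)` bounds `ρ`, the excess over `β` and `η`, so all three tend
  -- to `0`.
  have hnot : ∀ n : ℕ, ∃ x ∈ K, ∃ ρ : ℝ, 0 < ρ ∧ ρ ≤ 1 / ((n : ℝ) + 1) ∧
      ¬ IsRich K (β + 1 / ((n : ℝ) + 1)) (1 / ((n : ℝ) + 1)) x ρ := by
    intro n
    by_contra! hcon
    have h1 : 1 / ((n : ℝ) + 1) ≤ 1 := by
      rw [div_le_one (by positivity)]
      linarith [n.cast_nonneg (α := ℝ)]
    have h2 : IsLowerExponent K (β + 1 / ((n : ℝ≥0) + 1)) := by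
      refine isLowerExponent_of_isRich (η := 1 / ((n : ℝ) + 1)) (by positivity) h1
        (by positivity) h1 fun x hx ρ hρ hρ' => ?_
      have := hcon x hx ρ hρ hρ'
      push_cast
      exact this
    have h3 : ((β + 1 / ((n : ℝ≥0) + 1) : ℝ≥0) : ℝ≥0∞) ≤ lowerDim K :=
      le_iSup₂_of_le (f := fun (α : ℝ≥0) (_ : 0 < α ∧ IsLowerExponent K α) => (α : ℝ≥0∞))
        _ ⟨by positivity, h2⟩ le_rfl
    rw [← ENNReal.coe_toNNReal htop, ENNReal.coe_le_coe, ← hβ] at h3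
    have h4 : (0 : ℝ≥0) < 1 / ((n : ℝ≥0) + 1) := by positivity
    exact absurd h3 (not_le.2 (lt_add_of_pos_right β h4))
  choose x hx ρ hρ hρ' hrich using hnot
  obtain ⟨F, φ, hFne, hFc, hφ, hF⟩ := exists_subseq_tendsto_miniset hK hx fun n => (ρ n)⁻¹
  have hc : ∀ n : ℕ, (n : ℝ) + 1 ≤ (ρ n)⁻¹ := fun n => by
    rw [le_inv_comm₀ (by positivity) (hρ n), ← one_div]
    exact hρ' n
  have hctop : Tendsto (fun n => (ρ n)⁻¹) atTop atTop :=
    tendsto_atTop_mono (fun n => le_trans (by linarith) (hc n)) tendsto_natCast_atTop_atTop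
  refine ⟨F, ⟨hFne, hFc, fun n => x (φ n), fun n => (ρ (φ n))⁻¹, fun n => hx _, fun n => ?_,
    hctop.comp hφ.tendsto_atTop, hF⟩, ?_⟩
  · linarith [hc (φ n), (φ n).cast_nonneg (α := ℝ)]
  by_contra! hlt
  obtain ⟨T, hT, hTs, hsum⟩ := exists_separatedBalls_of_lt_packingPreMeasure hlt one_pos
  rw [hβ'] at hsum
  have hsum' : (2 : ℝ) ^ (β : ℝ) < ∑ p ∈ T, p.2 ^ (β : ℝ) := by
    have h257 : (257 : ℝ≥0∞) ^ (β : ℝ) = ENNReal.ofReal (257 ^ (β : ℝ)) := by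
      rw [← ENNReal.ofReal_rpow_of_pos (by norm_num)]
      norm_num
    rw [h257, ENNReal.ofReal_lt_ofReal_iff_of_nonneg (by positivity)] at hsum
    have h1 : ∑ p ∈ T, (2 * p.2) ^ (β : ℝ) = 2 ^ (β : ℝ) * ∑ p ∈ T, p.2 ^ (β : ℝ) := by
      rw [Finset.mul_sum]
      exact Finset.sum_congr rfl fun p hp => Real.mul_rpow zero_le_two (hT p hp).2.1.le
    -- Only `4 ≤ 257` is used: one factor `2` comes from diameters, the other from richness.
    have h2 : (2 : ℝ) ^ (β : ℝ) * 2 ^ (β : ℝ) ≤ 257 ^ (β : ℝ) := by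
      rw [← Real.mul_rpow zero_le_two zero_le_two]
      exact Real.rpow_le_rpow (by norm_num) (by norm_num) β.coe_nonneg
    rw [h1] at hsum
    exact lt_of_mul_lt_mul_left (h2.trans_lt hsum) (by positivity)
  have hη : Tendsto (fun n => 1 / ((φ n : ℝ) + 1)) atTop (𝓝 0) :=
    tendsto_one_div_add_atTop_nhds_zero_nat.comp hφ.tendsto_atTop
  have ht : Tendsto (fun n => (β : ℝ) + 1 / ((φ n : ℝ) + 1)) atTop (𝓝 β) := by
    simpa using hη.const_add (β : ℝ)
  obtain ⟨n, hn⟩ := (eventually_isRich (fun n => inv_pos.2 (hρ (φ n))) hF ht hη hT hTs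
    hsum').exists
  rw [inv_inv] at hn
  exact hrich (φ n) hn

end Packing

end LowerTangent

theorem mainTheorem3 (d : ℕ) (K : Set (EuclideanSpace ℝ (Fin d)))
    (hne : K.Nonempty) (hK : IsCompact K) :
    LowerTangent.lowerDim K < ⊤ ∧
      ∃ F : Set (EuclideanSpace ℝ (Fin d)), LowerTangent.IsWeakTangent K F ∧
        LowerTangent.packingPreMeasure (LowerTangent.lowerDim K).toReal F
          ≤ (257 : ℝ≥0∞) ^ (LowerTangent.lowerDim K).toReal ∧
        LowerTangent.packingMeasure (LowerTangent.lowerDim K).toReal F < ⊤ := by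
  obtain ⟨F, hF, hle⟩ := LowerTangent.exists_isWeakTangent_packingPreMeasure_le hne hK
  refine ⟨(LowerTangent.lowerDim_le_finrank hne).trans_lt (ENNReal.natCast_lt_top _), F, hF, hle,
    ?_⟩
  exact ((LowerTangent.packingMeasure_le_packingPreMeasure _ F).trans hle).trans_lt
    (ENNReal.rpow_lt_top_of_nonneg ENNReal.toReal_nonneg (by simp))
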